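/- Let $X$ be a set and let $X'=\{x' : x\in X\}$ be a disjoint copy of $X$. A partition on $X$ is a partition of the set $X\cup X'$ into nonempty pairwise disjoint blocks. The partition monoid $\mathcal P_X$ is the set of all partitions on $X$ with the following product. For $\alpha,\beta\in\mathcal P_X$ let $X''=\{x'' : x\in X\}$ be a further disjoint copy of $X$, and consider the graph on $X\cup X''\cup X'$ in which two vertices of $X\cup X''$ are adjacent if they lie in the same block of $\alpha$ after renaming each lower vertex $x'$ of $\alpha$ to $x''$, and two vertices of $X''\cup X'$ are adjacent if they lie in the same block of $\beta$ after renaming each upper vertex $x$ of $\beta$ to $x''$. Two elements of $X\cup X'$ lie in the same block of $\alpha\beta$ if and only if they are joined by a path in this graph. The identity of $\mathcal P_X$ is the partition with blocks $\{x,x'\}$ ($x\in X$). Let $\mathcal E_X=\{\alpha\in\mathcal P_X : \alpha^2=\alpha\}$ be the set of idempotent partitions, and let $\mathcal S_X$ be the group of units of $\mathcal P_X$ (which is isomorphic to the symmetric group on $X$). For a semigroup $S$ and a subset $T\subseteq S$, the relative rank $\operatorname{rank}(S:T)$ is the minimum cardinality of a subset $U\subseteq S$ such that $S$ is generated as a semigroup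 by $T\cup U$. **Theorem.** If $X$ is any infinite set, then $$\operatorname{rank}(\mathcal P_X:\mathcal E_X)=\operatorname{rank}(\mathcal P_X:\mathcal E_X\cup\mathcal S_X)=2.$$ -/

import Mathlib

universe u

/-- A partition on `X`: a partition of the disjoint union of `X` and a copy `X'` of `X` into
nonempty blocks, given by the equivalence relation "lie in the same block".
`Sum.inl x` is the upper vertex `x` and `Sum.inr x` is the lower vertex `x'`. -/
@[ext]
structure PartitionMonoid (X : Type u) where
  /-- the equivalence relation whose classes are the blocks -/
  rel : Setoid (X ⊕ X)

namespace PartitionMonoid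

variable {X : Type u}

/-- The vertices of the product graph of two partitions: an upper, a middle and a lower row, each
a copy of `X`. -/
inductive Vertex (X : Type u) : Type u
  | upper (x : X) : Vertex X
  | middle (x : X) : Vertex X
  | lower (x : X) : Vertex X

/-- The vertices of the first factor: its lower row is the middle row of the product graph. -/
def Vertex.ofFirst : X ⊕ X → Vertex X := Sum.elim Vertex.upper Vertex.middle

/-- The vertices of the second factor: its upper row is the middle row of the product graph. -/
def Vertex.ofSecond : X ⊕ X → Vertex X := Sum.elim Vertex.middle Vertex.lower

/-- The vertices of the product: the upper and the lower row of the product graph. -/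
def Vertex.outer : X ⊕ X → Vertex X := Sum.elim Vertex.upper Vertex.lower

/-- The edges of the product graph of `α` and `β`: those of `α` placed between the upper and the
middle row, and those of `β` placed between the middle and the lower row. -/
inductive ProductEdge (α β : PartitionMonoid X) : Vertex X → Vertex X → Prop
  | first {a b : X ⊕ X} (h : α.rel a b) : ProductEdge α β (Vertex.ofFirst a) (Vertex.ofFirst b)
  | second {a b : X ⊕ X} (h : β.rel a b) : ProductEdge α β (Vertex.ofSecond a) (Vertex.ofSecond b)

/-- The product of `α` and `β`: two vertices of the outer rows lie in the same block if and only
if they are joined by a path in the product graph. -/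
instance : Mul (PartitionMonoid X) where
  mul α β := ⟨(Relation.EqvGen.setoid (ProductEdge α β)).comap Vertex.outer⟩

/-- The identity partition, with the blocks `{x, x'}`. -/
instance : One (PartitionMonoid X) where
  one := ⟨Setoid.ker (Sum.elim id id)⟩

theorem mul_rel_iff (α β : PartitionMonoid X) (a b : X ⊕ X) :
    (α * β).rel a b ↔
      Relation.EqvGen (ProductEdge α β) (Vertex.outer a) (Vertex.outer b) := Iff.rfl

theorem one_rel_iff (a b : X ⊕ X) :
    (1 : PartitionMonoid X).rel a b ↔ Sum.elim id id a = Sum.elim id id b := Iff.rfl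

/-- A set of upper vertices (`p`) together with a set of lower vertices (`q`) is a union of
blocks of `α`. Used only to prove the monoid laws. -/
def Saturated (α : PartitionMonoid X) (p q : X → Prop) : Prop :=
  ∀ a b : X ⊕ X, α.rel a b → (Sum.elim p q a ↔ Sum.elim p q b)

theorem ext_of_saturated {α β : PartitionMonoid X}
    (h : ∀ p q, Saturated α p q ↔ Saturated β p q) : α = β := by
  have key : ∀ {γ δ : PartitionMonoid X}, (∀ p q, Saturated δ p q → Saturated γ p q) →
      ∀ a b, γ.rel a b → δ.rel a b := by
    intro γ δ hh a b hab
    have h1 : Saturated δ (fun x => δ.rel a (Sum.inl x)) (fun x => δ.rel a (Sum.inr x)) := by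
      rintro (c | c) (d | d) hcd <;>
        exact ⟨fun h => δ.rel.trans h hcd, fun h => δ.rel.trans h (δ.rel.symm hcd)⟩
    have h2 := hh _ _ h1 a b hab
    rcases a with a | a <;> rcases b with b | b <;> exact h2.1 (δ.rel.refl _)
  ext a b
  exact ⟨key (fun p q => (h p q).2) a b, key (fun p q => (h p q).1) a b⟩

theorem saturated_mul (α β : PartitionMonoid X) (p q : X → Prop) :
    Saturated (α * β) p q ↔ ∃ m, Saturated α p m ∧ Saturated β m q := by
  constructor
  · intro h
    let F : Vertex X → Prop := fun v =>
      ∃ a, Sum.elim p q a ∧ Relation.EqvGen (ProductEdge α β) (Vertex.outer a) v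
    have hF : ∀ v w, ProductEdge α β v w → (F v ↔ F w) := fun v w e =>
      ⟨fun ⟨a, ha, hv⟩ => ⟨a, ha, hv.trans _ _ _ (.rel _ _ e)⟩,
        fun ⟨a, ha, hv⟩ => ⟨a, ha, hv.trans _ _ _ (.symm _ _ (.rel _ _ e))⟩⟩
    have hout : ∀ a, F (Vertex.outer a) ↔ Sum.elim p q a := fun a =>
      ⟨fun ⟨b, hb, hv⟩ => (h b a hv).1 hb, fun ha => ⟨a, ha, .refl _⟩⟩
    have hp : ∀ x, F (Vertex.upper x) ↔ p x := fun x => hout (Sum.inl x)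
    have hq : ∀ x, F (Vertex.lower x) ↔ q x := fun x => hout (Sum.inr x)
    refine ⟨fun x => F (Vertex.middle x), fun a b hab => ?_, fun a b hab => ?_⟩
    · have := hF _ _ (ProductEdge.first (β := β) hab)
      rcases a with a | a <;> rcases b with b | b <;>
        simpa [Vertex.ofFirst, hp] using this
    · have := hF _ _ (ProductEdge.second (α := α) hab)
      rcases a with a | a <;> rcases b with b | b <;>
        simpa [Vertex.ofSecond, hq] using this
  · rintro ⟨m, h1, h2⟩ a b hab
    let G : Vertex X → Prop := fun v => match v with
      | .upper x => p x
      | .middle x => m x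
      | .lower x => q x
    have hG : ∀ v w, Relation.EqvGen (ProductEdge α β) v w → (G v ↔ G w) := by
      intro v w e
      induction e with
      | rel v w e =>
        cases e with
        | @first a b h =>
          have := h1 _ _ h
          rcases a with a | a <;> rcases b with b | b <;> exact this
        | @second a b h =>
          have := h2 _ _ h
          rcases a with a | a <;> rcases b with b | b <;> exact this
      | refl => exact Iff.rfl
      | symm _ _ _ ih => exact ih.symm
      | trans _ _ _ _ _ ih1 ih2 => exact ih1.trans ih2
    have := hG _ _ hab
    rcases a with a | a <;> rcases b with b | b <;> exact this

theorem saturated_one (p q : X → Prop) : Saturated (1 : PartitionMonoid X) p q ↔ p = q := by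
  constructor
  · intro h
    funext x
    exact propext (h (Sum.inl x) (Sum.inr x) rfl)
  · rintro rfl a b hab
    have hab : Sum.elim id id a = Sum.elim id id b := hab
    rcases a with a | a <;> rcases b with b | b <;> simp_all

/-- The partition monoid on `X`. -/
instance : Monoid (PartitionMonoid X) where
  mul_assoc α β γ := ext_of_saturated fun p q => by
    simp only [saturated_mul]
    constructor
    · rintro ⟨n, ⟨m, h1, h2⟩, h3⟩
      exact ⟨m, h1, n, h2, h3⟩
    · rintro ⟨m, h1, n, h2, h3⟩
      exact ⟨n, ⟨m, h1, h2⟩, h3⟩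
  one_mul α := ext_of_saturated fun p q => by
    simp [saturated_mul, saturated_one]
  mul_one α := ext_of_saturated fun p q => by
    simp [saturated_mul, saturated_one]

/-- The set of all idempotent partitions on `X`. -/
def idempotents (X : Type u) : Set (PartitionMonoid X) := {α | IsIdempotentElem α}

/-- The symmetric group on `X`, as the set of units of the partition monoid on `X`. -/
def units (X : Type u) : Set (PartitionMonoid X) := {α | IsUnit α}

end PartitionMonoid

/-- The relative rank of a semigroup `S` modulo a subset `T`: the least cardinality of a subset
`U` of `S` such that `T ∪ U` generates `S` as a semigroup. -/
noncomputable def relativeRank (S : Type u) [Semigroup S] (T : Set S) : Cardinal.{u} :=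
  sInf {c : Cardinal.{u} | ∃ U : Set S, Subsemigroup.closure (T ∪ U) = ⊤ ∧ c = Cardinal.mk U}

section RelativeRank

variable {M : Type u} [Monoid M]

/-! Upper bound: a bijection `X ⊕ X ≃ X` puts both rows of any partition into one copy of `X`, so
every partition is a fixed `ofMap`, times an idempotent `double`, times a fixed `coMap`
(`ofMap_mul_double_mul_coMap`). Lower bound: in any monoid, an idempotent with a one-sided inverse
is 1. Hence generating a non-unit with a right inverse takes an extra generator of that kind, and
likewise on the left; one element serving both purposes would be a unit. An injective,
non-surjective map supplies such non-units. Monotonicity in `T` gives both equalities. -/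

theorem IsIdempotentElem.eq_one_of_mul_eq_one_right {a b : M} (ha : IsIdempotentElem a)
    (hab : a * b = 1) : a = 1 := by
  rw [← hab, ← ha.eq, mul_assoc, hab, mul_one, ha.eq]

theorem IsIdempotentElem.eq_one_of_mul_eq_one_left {a b : M} (ha : IsIdempotentElem a)
    (hba : b * a = 1) : a = 1 := by
  rw [← hba, ← ha.eq, ← mul_assoc, hba, one_mul, ha.eq]

/-- The elements that are units as soon as they have a right inverse. -/
def unitsOfRightInvertible (M : Type u) [Monoid M] : Subsemigroup M where
  carrier := {a | (∃ b, a * b = 1) → IsUnit a}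
  mul_mem' := by
    rintro a b ha hb ⟨c, hc⟩
    rw [mul_assoc] at hc
    have hau : IsUnit a := ha ⟨_, hc⟩
    -- As `a` is a unit, `b * c` is its inverse, so `c * a` is a right inverse of `b`.
    refine hau.mul (hb ⟨c * a, hau.mul_left_cancel ?_⟩)
    rw [← mul_assoc b, ← mul_assoc a, hc, one_mul, mul_one]

/-- The elements that are units as soon as they have a left inverse. -/
def unitsOfLeftInvertible (M : Type u) [Monoid M] : Subsemigroup M where
  carrier := {a | (∃ b, b * a = 1) → IsUnit a}
  mul_mem' := by
    rintro a b ha hb ⟨c, hc⟩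
    rw [← mul_assoc] at hc
    have hbu : IsUnit b := hb ⟨_, hc⟩
    refine (ha ⟨b * c, hbu.mul_right_cancel ?_⟩).mul hbu
    rw [mul_assoc (b * c), mul_assoc b, ← mul_assoc c, hc, one_mul, mul_one]

/-- A monoid with an element that is invertible on one side only is not generated by its
idempotents, its units and one further element. -/
theorem closure_idempotents_units_subsingleton_ne_top {a b : M} (hab : a * b = 1)
    (hba : b * a ≠ 1) {U : Set M} (hU : U.Subsingleton) :
    Subsemigroup.closure (({e : M | IsIdempotentElem e} ∪ {u : M | IsUnit u}) ∪ U) ≠ ⊤ := by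
  intro htop
  have hunit : ∀ c d : M, IsUnit c → c * d = 1 → d * c = 1 := by
    intro c d hc hcd
    exact hc.mul_left_cancel (by rw [← mul_assoc, hcd, one_mul, mul_one])
  have ha : ¬ IsUnit a := fun h => hba (hunit a b h hab)
  have hb : ¬ IsUnit b := fun h => hba <| h.mul_right_cancel <| by
    rw [mul_assoc, hab, one_mul, mul_one]
  have hR : ∃ c ∈ U, (∃ d, c * d = 1) ∧ ¬ IsUnit c := by
    -- Otherwise every generator lies in `unitsOfRightInvertible M`, forcing `a` to be a unit.
    by_contra! hcon
    have hle : Subsemigroup.closure (({e : M | IsIdempotentElem e} ∪ {u : M | IsUnit u}) ∪ U) ≤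
        unitsOfRightInvertible M := by
      rw [Subsemigroup.closure_le]
      rintro c ((hc | hc) | hc)
      · rintro ⟨d, hd⟩
        rw [IsIdempotentElem.eq_one_of_mul_eq_one_right hc hd]
        exact isUnit_one
      · exact fun _ => hc
      · exact hcon c hc
    rw [htop] at hle
    exact ha (hle (Subsemigroup.mem_top a) ⟨b, hab⟩)
  have hL : ∃ c ∈ U, (∃ d, d * c = 1) ∧ ¬ IsUnit c := by
    by_contra! hcon
    have hle : Subsemigroup.closure (({e : M | IsIdempotentElem e} ∪ {u : M | IsUnit u}) ∪ U) ≤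
        unitsOfLeftInvertible M := by
      rw [Subsemigroup.closure_le]
      rintro c ((hc | hc) | hc)
      · rintro ⟨d, hd⟩
        rw [IsIdempotentElem.eq_one_of_mul_eq_one_left hc hd]
        exact isUnit_one
      · exact fun _ => hc
      · exact hcon c hc
    rw [htop] at hle
    exact hb (hle (Subsemigroup.mem_top b) ⟨a, hab⟩)
  obtain ⟨c, hcU, ⟨r, hr⟩, hc⟩ := hR
  obtain ⟨c', hcU', ⟨l, hl⟩, -⟩ := hL
  obtain rfl := hU hcU hcU'
  obtain rfl := left_inv_eq_right_inv hl hr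
  exact hc ⟨⟨c, l, hr, hl⟩, rfl⟩

theorem relativeRank_anti {S : Type u} [Semigroup S] {T T' : Set S} (h : T ⊆ T') :
    relativeRank S T' ≤ relativeRank S T := by
  -- Nonemptiness matters: the infimum of the empty set of cardinals is 0.
  refine le_csInf ⟨_, Set.univ, by simp, rfl⟩ ?_
  rintro _ ⟨U, hU, rfl⟩
  refine csInf_le' ⟨U, top_le_iff.1 ?_, rfl⟩
  rw [← hU]
  exact Subsemigroup.closure_mono (Set.union_subset_union_left U h)

theorem two_le_relativeRank_idempotents_units {a b : M} (hab : a * b = 1) (hba : b * a ≠ 1) :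
    2 ≤ relativeRank M ({e : M | IsIdempotentElem e} ∪ {u : M | IsUnit u}) := by
  refine le_csInf ⟨_, Set.univ, by simp, rfl⟩ ?_
  rintro _ ⟨U, hU, rfl⟩
  rw [Cardinal.two_le_iff_one_lt]
  by_contra! hcard
  exact closure_idempotents_units_subsingleton_ne_top hab hba
    (Cardinal.mk_le_one_iff_set_subsingleton.1 hcard) hU

end RelativeRank

namespace PartitionMonoid

variable {X : Type u}

/-- The partition in which `x` is joined to `(f x)'` for each `x`. -/
def ofMap (f : X → X) : PartitionMonoid X := ⟨Setoid.ker (Sum.elim f id)⟩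

/-- The partition in which `f x` is joined to `x'` for each `x`. -/
def coMap (f : X → X) : PartitionMonoid X := ⟨Setoid.ker (Sum.elim id f)⟩

/-- The partition with blocks `C ∪ C'`, for `C` a class of the equivalence relation `r`. -/
def double (r : Setoid X) : PartitionMonoid X := ⟨r.comap (Sum.elim id id)⟩

/-- Saturated pairs determine a partition and turn products into composition of relations, so the
products below reduce to identities between predicates. -/
theorem saturated_ofMap (f : X → X) (p q : X → Prop) :
    Saturated (ofMap f) p q ↔ p = q ∘ f := by
  constructor
  · intro h
    funext x
    exact propext (h (Sum.inl x) (Sum.inr (f x)) rfl)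
  · rintro rfl a b hab
    have hq : Sum.elim (q ∘ f) q = q ∘ Sum.elim f id := by
      funext c
      rcases c with c | c <;> rfl
    rw [hq]
    exact iff_of_eq (congrArg q hab)

theorem saturated_coMap (f : X → X) (p q : X → Prop) :
    Saturated (coMap f) p q ↔ p ∘ f = q := by
  constructor
  · intro h
    funext x
    exact propext (h (Sum.inl (f x)) (Sum.inr x) rfl)
  · rintro rfl a b hab
    have hp : Sum.elim p (p ∘ f) = p ∘ Sum.elim id f := by
      funext c
      rcases c with c | c <;> rfl
    rw [hp]
    exact iff_of_eq (congrArg p hab)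

theorem saturated_double (r : Setoid X) (p q : X → Prop) :
    Saturated (double r) p q ↔ p = q ∧ ∀ x y, r x y → (p x ↔ p y) := by
  constructor
  · intro h
    exact ⟨funext fun x => propext (h (Sum.inl x) (Sum.inr x) (r.refl x)),
      fun x y hxy => h (Sum.inl x) (Sum.inl y) hxy⟩
  · rintro ⟨rfl, h⟩ a b hab
    rcases a with a | a <;> rcases b with b | b <;> exact h _ _ hab

theorem isIdempotentElem_double (r : Setoid X) : IsIdempotentElem (double r) :=
  ext_of_saturated fun p q => by
    simp only [saturated_mul, saturated_double]
    constructor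
    · rintro ⟨m, ⟨rfl, h⟩, rfl, -⟩
      exact ⟨rfl, h⟩
    · rintro ⟨rfl, h⟩
      exact ⟨p, ⟨rfl, h⟩, rfl, h⟩

theorem ofMap_mul_double_mul_coMap (h : X ⊕ X ≃ X) (δ : PartitionMonoid X) :
    ofMap (h ∘ Sum.inl) * double (δ.rel.comap h.symm) * coMap (h ∘ Sum.inr) = δ := by
  refine ext_of_saturated fun p q => ?_
  simp only [saturated_mul, saturated_ofMap, saturated_double, saturated_coMap]
  constructor
  · rintro ⟨m, ⟨_, rfl, rfl, hm⟩, rfl⟩ a b hab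
    have := hm (h a) (h b) (by simpa [Setoid.comap_rel] using hab)
    rcases a with a | a <;> rcases b with b | b <;> exact this
  · intro hδ
    refine ⟨Sum.elim p q ∘ h.symm, ⟨Sum.elim p q ∘ h.symm, ?_, rfl, fun x y hxy => ?_⟩, ?_⟩
    · funext x
      simp
    · exact hδ _ _ hxy
    · funext x
      simp

theorem ofMap_mul_coMap {f : X → X} (hf : Function.Injective f) : ofMap f * coMap f = 1 := by
  refine ext_of_saturated fun p q => ?_
  simp only [saturated_mul, saturated_ofMap, saturated_coMap, saturated_one]
  constructor
  · rintro ⟨m, rfl, rfl⟩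
    rfl
  · rintro rfl
    -- Injectivity lets any predicate extend along `f`.
    obtain ⟨m, hm⟩ := hf.surjective_comp_right p
    exact ⟨m, hm.symm, hm⟩

theorem coMap_mul_ofMap_ne_one {f : X → X} (hf : ¬ Function.Surjective f) :
    coMap f * ofMap f ≠ 1 := by
  intro h
  refine hf fun y => ?_
  -- Upper vertices outside the range of `f` are cut off from the lower row; for the identity the
  -- two predicates would have to agree.
  have hsat : Saturated (coMap f * ofMap f) (fun x => ∃ z, f z = x) (fun _ => True) := by
    rw [saturated_mul]
    refine ⟨fun _ => True, (saturated_coMap f _ _).2 ?_, (saturated_ofMap f _ _).2 rfl⟩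
    funext x
    exact eq_true ⟨x, rfl⟩
  rw [h, saturated_one] at hsat
  exact of_eq_true (congrFun hsat y)

theorem nonempty_sum_self_equiv (X : Type u) [Infinite X] : Nonempty (X ⊕ X ≃ X) :=
  Cardinal.eq.1 <| by
    rw [← Cardinal.add_def, Cardinal.add_eq_self (Cardinal.aleph0_le_mk X)]

theorem relativeRank_idempotents_le_two (X : Type u) [Infinite X] :
    relativeRank (PartitionMonoid X) (idempotents X) ≤ 2 := by
  obtain ⟨h⟩ := nonempty_sum_self_equiv X
  let U : Set (PartitionMonoid X) := {ofMap (h ∘ Sum.inl), coMap (h ∘ Sum.inr)}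
  have hU : Subsemigroup.closure (idempotents X ∪ U) = ⊤ := by
    refine top_le_iff.1 fun δ _ => ?_
    rw [← ofMap_mul_double_mul_coMap h δ]
    refine mul_mem (mul_mem ?_ ?_) ?_ <;> apply Subsemigroup.subset_closure
    · exact Or.inr (Or.inl rfl)
    · exact Or.inl (isIdempotentElem_double _)
    · exact Or.inr (Or.inr rfl)
  refine le_trans (csInf_le' ⟨U, hU, rfl⟩) ?_
  refine Cardinal.mk_insert_le.trans ?_
  rw [Cardinal.mk_singleton, one_add_one_eq_two]

theorem two_le_relativeRank_idempotents_union_units (X : Type u) [Infinite X] :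
    2 ≤ relativeRank (PartitionMonoid X) (idempotents X ∪ units X) := by
  obtain ⟨h⟩ := nonempty_sum_self_equiv X
  have hinj : Function.Injective (h ∘ Sum.inl) := h.injective.comp Sum.inl_injective
  have hsurj : ¬ Function.Surjective (h ∘ Sum.inl) := fun hs => by
    obtain ⟨x⟩ := (inferInstance : Nonempty X)
    obtain ⟨y, hy⟩ := hs (h (Sum.inr x))
    exact Sum.inl_ne_inr (h.injective hy)
  exact two_le_relativeRank_idempotents_units (ofMap_mul_coMap hinj)
    (coMap_mul_ofMap_ne_one hsurj)

end PartitionMonoid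

theorem mainTheorem6 (X : Type u) [Infinite X] :
    relativeRank (PartitionMonoid X) (PartitionMonoid.idempotents X) = 2 ∧
      relativeRank (PartitionMonoid X)
        (PartitionMonoid.idempotents X ∪ PartitionMonoid.units X) = 2 := by
  have hanti := relativeRank_anti (S := PartitionMonoid X)
    (Set.subset_union_left (s := PartitionMonoid.idempotents X) (t := PartitionMonoid.units X))
  have hle := PartitionMonoid.relativeRank_idempotents_le_two X
  have hge := PartitionMonoid.two_le_relativeRank_idempotents_union_units X
  exact ⟨le_antisymm hle (hge.trans hanti), le_antisymm (hanti.trans hle) hge⟩
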